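/- Let $m\ge 1$ be an integer, let $X>0$, and let $a_0,\dots,a_{m-1}\in C^1[0,X]$ be real-valued. For $i,j\in\{0,\dots,m-1\}$ put $a_{ij}(x):=a_{2i-j}(x)$ if $0\le 2i-j<m$, $a_{ij}(x):=-1$ if $2i-j=m$, and $a_{ij}(x):=0$ if $2i-j<0$ or $2i-j>m$. Assume that the Routh--Hurwitz condition $$(-1)^k\det\big(a_{ij}(x)\big)_{0\le i,j\le k-1}>0,\qquad k=1,\dots,m,$$ holds for all $x\in[0,X]$. For each $x\in[0,X]$ let $\Phi^1(\cdot\,;x)$ and $\Phi^m(\cdot\,;x)$ be the solutions on $\mathbb R$, which exist and are unique, of the equation $$\frac{d^m\Phi}{d\xi^m}=a_{m-1}(x)\frac{d^{m-1}\Phi}{d\xi^{m-1}}+\dots+a_0(x)\Phi,\qquad \xi\in\mathbb R,$$ such that, respectively, $\Phi^1(0;x)=1$ and $\partial_\xi^i\Phi^1(0;x)=0$ for $1\le i\le m-1$; and $\partial_\xi^{m-1}\Phi^m(0;x)=1$ and $\partial_\xi^i\Phi^m(0;x)=0$ for $0\le i\le m-2$. Then there exist $\chi>0$ and $C_\Phi>0$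 such that $$|\partial_\xi^i\Phi^1(\xi;x)|\le C_\Phi(1+\xi^{m-1})e^{-\chi\xi},\qquad |\partial_\xi^i\Phi^m(\xi;x)|\le C_\Phi(1+\xi^{m-1})e^{-\chi\xi}$$ for all $i\in\{0,\dots,m-1\}$, $\xi\ge 0$ and $x\in[0,X]$. -/

import Mathlib

/-- The entry `a_{ij}` of the Routh-Hurwitz matrix of the polynomial
`λ^m - a_{m-1} λ^{m-1} - ⋯ - a_1 λ - a_0`: it is `a_{2i-j}` for `0 ≤ 2i-j < m`,
`-1` for `2i-j = m`, and `0` for `2i-j < 0` or `2i-j > m`. -/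
def hurwitzEntry {m : ℕ} (a : Fin m → ℝ) (i j : ℕ) : ℝ :=
  if j ≤ 2 * i then
    if h : 2 * i - j < m then a ⟨2 * i - j, h⟩
    else if 2 * i - j = m then -1 else 0
  else 0

/-- The Routh-Hurwitz condition: `(-1)^k det (a_{ij})_{0 ≤ i, j < k} > 0` for `k = 1, …, m`. -/
def RouthHurwitz {m : ℕ} (a : Fin m → ℝ) : Prop :=
  ∀ k : ℕ, 1 ≤ k → k ≤ m →
    0 < (-1 : ℝ) ^ k * (Matrix.of fun i j : Fin k => hurwitzEntry a i j).det

/-- `φ` is the solution on `ℝ` of the equation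
`φ^{(m)} = a_{m-1} φ^{(m-1)} + ⋯ + a_0 φ` with constant coefficients, whose derivative of order `j`
at `0` is `1` and whose other derivatives of order less than `m` at `0` vanish.
(Orders of derivatives count from `0`, so this is the fundamental solution number `j + 1`.) -/
structure IsFundamentalSolution {m : ℕ} (a : Fin m → ℝ) (j : Fin m) (φ : ℝ → ℝ) : Prop where
  contDiff : ContDiff ℝ m φ
  ode : ∀ ξ : ℝ, iteratedDeriv m φ ξ = ∑ i : Fin m, a i * iteratedDeriv i φ ξ
  init : ∀ i : Fin m, iteratedDeriv i φ 0 = if i = j then 1 else 0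

/-! The Routh–Hurwitz condition puts every characteristic root in the open left half-plane
(`RouthHurwitz.re_neg`). The proof is algebraic: a Routh step lowers the degree by one and strips
one row and one column from each Hurwitz determinant. Non-vanishing on `0 ≤ re z` is carried back up
together with the inequality `|p(-z)| ≤ |p(z)|`, without which the induction would not close.

Since the coefficients are continuous on a compact interval, the roots for all `x` are uniformly
bounded and satisfy `re r ≤ -2χ` for one `χ > 0` (`exists_uniform_root_gap`).

Decay follows by splitting off one root at a time (`exists_decay_of_roots`): `s' - r s` solves an
equation of lower order, and `s` is recovered with the integrating factor `e^{-rξ}`. As `-2χ` lies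
strictly below the claimed rate `-χ`, no polynomial factor arises even for multiple roots, and the
constant depends only on `m`, `χ` and the bound on the roots. -/

/-! ### Routh reduction and the Routh–Hurwitz criterion -/

/-- The Hurwitz matrix entry `b_{2i-j}`, with `b` extended by zero to negative indices. -/
def seqHurwitz (b : ℕ → ℝ) (i j : ℕ) : ℝ := if j ≤ 2 * i then b (2 * i - j) else 0

/-- One step of the Routh reduction, which lowers the degree of `∑ b_i z^i` by one. -/
noncomputable def routhStep (b : ℕ → ℝ) (i : ℕ) : ℝ :=
  if Even i then b (i + 1) else b (i + 1) - b 0 / b 1 * b (i + 2)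

/-- The first row is `(b 0, 0, …, 0)`. In the remaining minor, subtracting `b 0 / b 1` times the
preceding column from each odd-indexed column (counting from 0) leaves the Hurwitz matrix of the
reduced sequence. -/
theorem det_seqHurwitz_succ (b : ℕ → ℝ) (hb : b 1 ≠ 0) (k : ℕ) :
    (Matrix.of fun i j : Fin (k + 1) => seqHurwitz b i j).det =
      b 0 * (Matrix.of fun i j : Fin k => seqHurwitz (routhStep b) i j).det := by
  rw [Matrix.det_succ_row_zero, Finset.sum_eq_single 0]
  · have h : ((Matrix.of fun i j : Fin (k + 1) => seqHurwitz b i j).submatrix Fin.succ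
        (Fin.succAbove 0)).det
        = (Matrix.of fun i j : Fin k => seqHurwitz (routhStep b) i j).det := by
      cases k with
      | zero => simp
      | succ n =>
        apply Matrix.det_eq_of_forall_col_eq_smul_add_pred
          (fun j : Fin n => if Even (j : ℕ) then b 0 / b 1 else 0)
        · intro i
          simp [seqHurwitz, routhStep]
          congr 1
        · intro i j
          rcases Nat.even_or_odd' (j : ℕ) with ⟨l, hl | hl⟩
          · simp only [Matrix.submatrix_apply, Matrix.of_apply, seqHurwitz, routhStep,
              Fin.val_succ, Fin.succAbove_zero, Fin.val_castSucc, hl]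
            rcases lt_trichotomy l (i : ℕ) with h | h | h
            · obtain ⟨d, hd⟩ := Nat.exists_eq_add_of_lt h
              rw [hd]
              have e1 : 2 * (l + d + 1 + 1) - (2 * l + 1 + 1) = 2 * d + 2 := by omega
              have e2 : 2 * (l + d + 1) - (2 * l + 1) = 2 * d + 1 := by omega
              have e3 : 2 * (l + d + 1 + 1) - (2 * l + 1) = 2 * d + 3 := by omega
              rw [e1, e2, e3, if_pos (show 2 * l + 1 + 1 ≤ 2 * (l + d + 1 + 1) by omega),
                if_pos (show 2 * l + 1 ≤ 2 * (l + d + 1) by omega),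
                if_pos (show 2 * l + 1 ≤ 2 * (l + d + 1 + 1) by omega)]
              simp [parity_simps]
            -- The entry `b 0` of the minor must be cancelled by `b 1` beside it; this fixes the
            -- ratio `b 0 / b 1`.
            · rw [← h, if_pos (show 2 * l + 1 + 1 ≤ 2 * (l + 1) by omega),
                if_neg (show ¬ 2 * l + 1 ≤ 2 * l by omega),
                if_pos (show 2 * l + 1 ≤ 2 * (l + 1) by omega)]
              have e1 : 2 * (l + 1) - (2 * l + 1 + 1) = 0 := by omega
              have e3 : 2 * (l + 1) - (2 * l + 1) = 1 := by omega
              rw [e1, e3]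
              simp [hb]
            · rw [if_neg (show ¬ 2 * l + 1 + 1 ≤ 2 * ((i : ℕ) + 1) by omega),
                if_neg (show ¬ 2 * l + 1 ≤ 2 * (i : ℕ) by omega),
                if_neg (show ¬ 2 * l + 1 ≤ 2 * ((i : ℕ) + 1) by omega)]
              simp
          · simp only [Matrix.submatrix_apply, Matrix.of_apply, seqHurwitz, routhStep,
              Fin.val_succ, Fin.succAbove_zero, Fin.val_castSucc, hl]
            rcases lt_or_ge l (i : ℕ) with h | h
            · obtain ⟨d, hd⟩ := Nat.exists_eq_add_of_lt h
              rw [hd]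
              have e1 : 2 * (l + d + 1 + 1) - (2 * l + 1 + 1 + 1) = 2 * d + 1 := by omega
              have e2 : 2 * (l + d + 1) - (2 * l + 1 + 1) = 2 * d := by omega
              rw [e1, e2, if_pos (show 2 * l + 1 + 1 + 1 ≤ 2 * (l + d + 1 + 1) by omega),
                if_pos (show 2 * l + 1 + 1 ≤ 2 * (l + d + 1) by omega)]
              simp [parity_simps]
            · rw [if_neg (show ¬ 2 * l + 1 + 1 + 1 ≤ 2 * ((i : ℕ) + 1) by omega),
                if_neg (show ¬ 2 * l + 1 + 1 ≤ 2 * (i : ℕ) by omega)]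
              simp [parity_simps]
    rw [h]
    simp [seqHurwitz]
  · intro j _ hj
    have : ¬ (j : ℕ) = 0 := fun h => hj (Fin.ext h)
    simp [seqHurwitz, this]
  · simp

/-- With `q` the reduced polynomial, `q(z) + q(-z)` is twice its even part, which is the odd part of
the original divided by `z`. Adding `b 0 / b 1` times that even part to `z q(z)` undoes the
subtraction and restores the constant term. -/
theorem sum_eq_routhStep (b : ℕ → ℝ) (m : ℕ) (hb : b 1 ≠ 0) (hm : ∀ i, m + 1 < i → b i = 0)
    (z : ℂ) :
    ∑ i ∈ Finset.range (m + 2), (b i : ℂ) * z ^ i =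
      z * ∑ i ∈ Finset.range (m + 1), (routhStep b i : ℂ) * z ^ i +
      ((b 0 / b 1 / 2 : ℝ) : ℂ) * (∑ i ∈ Finset.range (m + 1), (routhStep b i : ℂ) * z ^ i +
        ∑ i ∈ Finset.range (m + 1), (routhStep b i : ℂ) * (-z) ^ i) := by
  have h0 : routhStep b (m + 1) = 0 := by
    unfold routhStep
    rw [hm (m + 1 + 1) (by omega), hm (m + 1 + 2) (by omega)]
    simp
  have key : ∀ w : ℂ, ∑ i ∈ Finset.range (m + 1), (routhStep b i : ℂ) * w ^ i =
      ∑ i ∈ Finset.range (m + 2), (routhStep b i : ℂ) * w ^ i := by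
    intro w
    rw [Finset.sum_range_succ _ (m + 1), h0]
    simp
  have hb' : (b 1 : ℂ) ≠ 0 := by exact_mod_cast hb
  conv_rhs => rw [key (-z)]; arg 2; rw [key z]
  rw [← Finset.sum_add_distrib, Finset.mul_sum, Finset.mul_sum, Finset.sum_range_succ' _ (m + 1),
    Finset.sum_range_succ' (fun i => _ * (_ + _)) (m + 1), ← add_assoc, ← Finset.sum_add_distrib]
  congr 1
  · refine Finset.sum_congr rfl fun i _ => ?_
    rw [neg_pow]
    rcases Nat.even_or_odd i with h | h
    · have h1 : Odd (i + 1) := h.add_one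
      rw [h1.neg_one_pow]
      simp only [routhStep, if_pos h]
      ring
    · have h1 : Even (i + 1) := h.add_one
      rw [h1.neg_one_pow]
      simp only [routhStep, if_pos h1, if_neg (Nat.not_even_iff_odd.2 h)]
      push_cast
      ring
  · simp [routhStep]
    field_simp
    norm_num

/-- A polynomial `∑ b_i z^i` with positive Hurwitz determinants has no zero in the closed right
half-plane, where moreover it dominates its reflection. -/
theorem hurwitz_stable (m : ℕ) : ∀ b : ℕ → ℝ, 0 < b m → (∀ i, m < i → b i = 0) →
    (∀ k, 1 ≤ k → k ≤ m → 0 < (Matrix.of fun i j : Fin k => seqHurwitz b i j).det) →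
    ∀ z : ℂ, 0 ≤ z.re → ∑ i ∈ Finset.range (m + 1), (b i : ℂ) * z ^ i ≠ 0 ∧
      Complex.normSq (∑ i ∈ Finset.range (m + 1), (b i : ℂ) * (-z) ^ i) ≤
        Complex.normSq (∑ i ∈ Finset.range (m + 1), (b i : ℂ) * z ^ i) := by
  induction m with
  | zero =>
    intro b hb _ _ z _
    simp [hb.ne']
  | succ m ih =>
    intro b hbm hb hD z hz
    have hb0 : 0 < b 0 := by
      have := hD 1 le_rfl (by omega)
      simpa [seqHurwitz] using this
    have hb1 : 0 < b 1 := by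
      rcases Nat.eq_zero_or_pos m with rfl | hm
      · exact hbm
      · have := hD 2 (by omega) (by omega)
        simp [Matrix.det_fin_two, seqHurwitz] at this
        exact (mul_pos_iff_of_pos_left hb0).1 this
    obtain ⟨hne, hle⟩ := ih (routhStep b) (by
        unfold routhStep
        rw [hb (m + 2) (by omega)]
        simpa using hbm)
      (fun i hi => by
        unfold routhStep
        rw [hb (i + 1) (by omega), hb (i + 2) (by omega)]
        simp)
      (fun k hk hkm => by
        have := hD (k + 1) (by omega) (by omega)
        rw [det_seqHurwitz_succ b hb1.ne'] at this
        exact (mul_pos_iff_of_pos_left hb0).1 this) z hz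
    have e1 := sum_eq_routhStep b m hb1.ne' hb z
    have e2 := sum_eq_routhStep b m hb1.ne' hb (-z)
    rw [neg_neg] at e2
    rw [e1, e2]
    set u := ∑ i ∈ Finset.range (m + 1), (routhStep b i : ℂ) * z ^ i with hu
    set v := ∑ i ∈ Finset.range (m + 1), (routhStep b i : ℂ) * (-z) ^ i with hv
    have hc : 0 < b 0 / b 1 / 2 := by positivity
    set c := b 0 / b 1 / 2 with hcd
    constructor
    -- A zero gives `|z + c| |u| = c |v| ≤ c |u|`. As `0 ≤ re z` and `u ≠ 0`, this forces `z = 0`,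
    -- where the value is `2 c u ≠ 0`.
    · intro h0
      have hupos := Complex.normSq_pos.2 hne
      have h1 : Complex.normSq (c * v) = Complex.normSq ((z + c) * u) := by
        have : (c : ℂ) * v = -((z + c) * u) := by linear_combination h0
        rw [this, Complex.normSq_neg]
      rw [map_mul, map_mul] at h1
      have h2 : Complex.normSq (z + c) = Complex.normSq z + 2 * c * z.re + c * c := by
        simp [Complex.normSq_apply]
        ring
      have h3 : Complex.normSq (c : ℂ) = c * c := Complex.normSq_ofReal c
      rw [h2, h3] at h1
      have h4 : Complex.normSq z * Complex.normSq u ≤ 0 := by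
        nlinarith [mul_le_mul_of_nonneg_left hle (mul_pos hc hc).le,
          mul_nonneg (mul_nonneg hc.le hz) hupos.le]
      have hz0 : z = 0 := by
        by_contra hz0
        have := mul_pos (Complex.normSq_pos.2 hz0) hupos
        linarith
      have huv : v = u := by rw [hu, hv, hz0, neg_zero]
      rw [huv, hz0] at h0
      have hcc : (c : ℂ) ≠ 0 := by exact_mod_cast hc.ne'
      have : (c : ℂ) * (2 * u) = 0 := by linear_combination h0
      simp [hcc, hne] at this
    · have h1 : Complex.normSq (z * u + c * (u + v)) - Complex.normSq (-z * v + c * (v + u)) =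
          Complex.normSq z * (Complex.normSq u - Complex.normSq v) +
            2 * c * z.re * Complex.normSq (u + v) := by
        simp [Complex.normSq_apply]
        ring
      have h2 := mul_nonneg (Complex.normSq_nonneg z) (sub_nonneg.2 hle)
      have h3 := mul_nonneg (mul_nonneg (mul_nonneg zero_le_two hc.le) hz)
        (Complex.normSq_nonneg (u + v))
      linarith

/-- The Routh-Hurwitz criterion. -/
theorem RouthHurwitz.re_neg {m : ℕ} {a : Fin m → ℝ} (h : RouthHurwitz a) {z : ℂ}
    (hz : z ^ m = ∑ i : Fin m, (a i : ℂ) * z ^ (i : ℕ)) : z.re < 0 := by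
  by_contra! hre
  -- The monic polynomial has coefficients `-a_i`, so its Hurwitz matrix is minus the given one;
  -- this absorbs the sign `(-1)^k`.
  set b : ℕ → ℝ := fun i => if hi : i < m then -a ⟨i, hi⟩ else if i = m then 1 else 0 with hb
  refine (hurwitz_stable m b (by simp [hb]) (fun i hi => ?_) (fun k hk hkm => ?_) z hre).1 ?_
  · simp [hb, hi.ne', hi.not_gt]
  · have := h k hk hkm
    have e : (Matrix.of fun i j : Fin k => seqHurwitz b i j) =
        -(Matrix.of fun i j : Fin k => hurwitzEntry a i j) := by
      ext i j
      simp only [Matrix.of_apply, Matrix.neg_apply, seqHurwitz, hurwitzEntry, hb]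
      split_ifs <;> simp
    rw [e, Matrix.det_neg]
    simpa using this
  · rw [Finset.sum_range_succ, Finset.sum_range]
    simp [hb, hz]

/-! ### Exponential decay from the location of the roots -/

open Polynomial in
/-- If the successive derivatives `s 0, s 1, …` of a function satisfy a linear equation with
constant coefficients whose characteristic roots lie in `‖r‖ ≤ R`, `re r ≤ -2χ`, they decay. -/
theorem exists_decay_of_roots {χ R : ℝ} (hχ : 0 < χ) (hR : 0 ≤ R) (n : ℕ) :
    ∃ C : ℝ, 0 ≤ C ∧ ∀ P : ℂ[X], P.Monic → P.natDegree = n →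
      (∀ r, P.IsRoot r → ‖r‖ ≤ R ∧ r.re ≤ -(2 * χ)) →
      ∀ s : ℕ → ℝ → ℂ, (∀ i ξ, HasDerivAt (s i) (s (i + 1) ξ) ξ) →
      (∀ i ξ, ∑ k ∈ Finset.range (n + 1), P.coeff k * s (i + k) ξ = 0) →
      ∀ M : ℝ, 0 ≤ M → (∀ i < n, ‖s i 0‖ ≤ M) →
      ∀ i < n, ∀ ξ, 0 ≤ ξ → ‖s i ξ‖ ≤ C * M * Real.exp (-χ * ξ) := by
  induction n with
  | zero => exact ⟨0, le_rfl, by simp⟩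
  | succ n ih =>
    obtain ⟨C, hC, ih⟩ := ih
    set K : ℝ := (1 + C) * (1 + R) with hK
    have hK0 : 0 ≤ K := by positivity
    -- `K` controls `t = s' - r s`, `1 + K / χ` controls `s 0`, and each further derivative `s (i +
    -- 1) = t i + r * s i` costs at most a factor `1 + R`.
    refine ⟨(1 + R) ^ n * (1 + K / χ + K), by positivity, ?_⟩
    intro P hP hPn hroot s hs hrec M hM h0
    obtain ⟨r, hr⟩ := Complex.exists_root (f := P) (by
      rw [← Polynomial.natDegree_pos_iff_degree_pos]; omega)
    obtain ⟨hrR, hrχ⟩ := hroot r hr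
    obtain ⟨Q, rfl⟩ := Polynomial.dvd_iff_isRoot.2 hr
    have hQ : Q.Monic := (Polynomial.monic_X_sub_C r).of_mul_monic_left hP
    have hQn : Q.natDegree = n := by
      rw [(Polynomial.monic_X_sub_C r).natDegree_mul hQ, Polynomial.natDegree_X_sub_C] at hPn
      omega
    set t : ℕ → ℝ → ℂ := fun i ξ => s (i + 1) ξ - r * s i ξ with ht
    have htd : ∀ i ξ, HasDerivAt (t i) (t (i + 1) ξ) ξ := fun i ξ =>
      (hs (i + 1) ξ).sub ((hs i ξ).const_mul r)
    have htrec : ∀ i ξ, ∑ k ∈ Finset.range (n + 1), Q.coeff k * t (i + k) ξ = 0 := by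
      intro i ξ
      have h := hrec i ξ
      rw [sub_mul] at h
      simp only [Polynomial.coeff_sub, Polynomial.coeff_C_mul, sub_mul,
        Finset.sum_sub_distrib] at h
      rw [Finset.sum_range_succ' _ (n + 1), Finset.sum_range_succ (fun k => r * Q.coeff k * _),
        Polynomial.coeff_eq_zero_of_natDegree_lt (n := n + 1) (by omega)] at h
      simp only [Polynomial.coeff_X_mul, Polynomial.coeff_X_mul_zero] at h
      simp only [zero_mul, mul_zero, add_zero] at h
      rw [← h, ← Finset.sum_sub_distrib]
      refine Finset.sum_congr rfl fun k _ => ?_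
      simp only [ht, add_assoc]
      ring
    have htb := ih Q hQ hQn (fun q hq => hroot q (by
        rw [Polynomial.IsRoot.def, Polynomial.eval_mul, hq.eq_zero, mul_zero])) t htd htrec
      ((1 + R) * M) (by positivity) (fun i hi => by
        have h1 := h0 (i + 1) (by omega)
        have h2 := h0 i (by omega)
        calc ‖s (i + 1) 0 - r * s i 0‖ ≤ ‖s (i + 1) 0‖ + ‖r * s i 0‖ := norm_sub_le _ _
          _ ≤ M + R * M := by rw [norm_mul]; gcongr
          _ = (1 + R) * M := by ring)
    have htK : ∀ i ≤ n, ∀ ξ, 0 ≤ ξ → i < n ∨ n = 0 → ‖t i ξ‖ ≤ K * M * Real.exp (-χ * ξ) := by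
      rintro i hi ξ hξ (hin | hn)
      · refine (htb i hin ξ hξ).trans ?_
        rw [hK, ← mul_assoc]
        gcongr
        linarith
      -- Here `Q = 1`, so the recurrence says `t = 0`.
      · subst hn
        have := htrec i ξ
        have hq : Q.coeff 0 = 1 := by rw [← hQ.leadingCoeff, Polynomial.leadingCoeff, hQn]
        simp [hq] at this
        rw [this, norm_zero]
        positivity
    have hs0 : ∀ ξ, 0 ≤ ξ → ‖s 0 ξ‖ ≤ (1 + K / χ) * M * Real.exp (-χ * ξ) := by
      intro ξ hξ
      set ρ := -r.re with hρ
      have hρχ : χ ≤ ρ - χ := by linarith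
      have hρ0 : 0 < ρ - χ := by linarith
      have hnorm : ∀ x : ℝ, ‖Complex.exp (-r * x)‖ = Real.exp (ρ * x) := by
        intro x
        rw [Complex.norm_exp]
        simp [hρ]
      -- Integrating factor: the derivative is bounded by `K M e^{(ρ - χ)x}`, whose primitive costs
      -- only `1 / (ρ - χ) ≤ 1 / χ`.
      have hder : ∀ x : ℝ, HasDerivAt (fun x : ℝ => Complex.exp (-r * x) * s 0 x)
          (Complex.exp (-r * x) * t 0 x) x := by
        intro x
        have h1 : HasDerivAt (fun x : ℝ => Complex.exp (-r * x))
            (Complex.exp (-r * x) * (-r)) x := by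
          have := ((Complex.ofRealCLM.hasDerivAt (x := x)).const_mul (-r)).cexp
          simpa using this
        refine (h1.mul (hs 0 x)).congr_deriv ?_
        simp only [ht]
        ring
      have hBder : ∀ x : ℝ, HasDerivAt
          (fun x : ℝ => M + K * M / (ρ - χ) * Real.exp ((ρ - χ) * x))
          (K * M * Real.exp ((ρ - χ) * x)) x := by
        intro x
        have h1 := ((((hasDerivAt_id x).const_mul (ρ - χ)).exp).const_mul
          (K * M / (ρ - χ))).const_add M
        refine h1.congr_deriv ?_
        simp only [id]
        field_simp
      have hb := image_norm_le_of_norm_deriv_right_le_deriv_boundary (a := 0) (b := ξ)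
        (fun x _ => (hder x).continuousAt.continuousWithinAt)
        (fun x _ => (hder x).hasDerivWithinAt) (B := fun x : ℝ =>
          M + K * M / (ρ - χ) * Real.exp ((ρ - χ) * x)) (by
          have := h0 0 (by omega)
          have h2 : 0 ≤ K * M / (ρ - χ) := by positivity
          simp
          linarith) hBder (fun x hx => by
          rw [norm_mul, hnorm]
          calc Real.exp (ρ * x) * ‖t 0 x‖ ≤ Real.exp (ρ * x) * (K * M * Real.exp (-χ * x)) := by
                gcongr
                exact htK 0 (Nat.zero_le _) x hx.1 (by omega)
            _ = K * M * Real.exp ((ρ - χ) * x) := by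
                rw [show (ρ - χ) * x = ρ * x + -χ * x by ring, Real.exp_add]; ring)
        ⟨hξ, le_rfl⟩
      simp only [norm_mul, hnorm] at hb
      have h3 : ‖s 0 ξ‖ = Real.exp (-ρ * ξ) * (Real.exp (ρ * ξ) * ‖s 0 ξ‖) := by
        rw [← mul_assoc, ← Real.exp_add]; simp
      rw [h3]
      calc _ ≤ Real.exp (-ρ * ξ) * (M + K * M / (ρ - χ) * Real.exp ((ρ - χ) * ξ)) := by gcongr
        _ = M * Real.exp (-ρ * ξ) + K * M / (ρ - χ) * Real.exp (-χ * ξ) := by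
            rw [show -χ * ξ = -ρ * ξ + (ρ - χ) * ξ by ring, Real.exp_add]; ring
        _ ≤ M * Real.exp (-χ * ξ) + K * M / χ * Real.exp (-χ * ξ) := by
            gcongr
            linarith
        _ = _ := by ring
    have hsi : ∀ i ≤ n, ∀ ξ, 0 ≤ ξ →
        ‖s i ξ‖ ≤ (1 + R) ^ i * (1 + K / χ + K) * M * Real.exp (-χ * ξ) := by
      intro i
      induction i with
      | zero =>
        intro _ ξ hξ
        refine (hs0 ξ hξ).trans ?_
        gcongr
        linarith
      | succ i ihi =>
        intro hi ξ hξ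
        have h1 := htK i (by omega) ξ hξ (by omega)
        have h2 := ihi (by omega) ξ hξ
        have h3 : s (i + 1) ξ = t i ξ + r * s i ξ := by simp [ht]
        rw [h3]
        calc _ ≤ ‖t i ξ‖ + ‖r‖ * ‖s i ξ‖ := by rw [← norm_mul]; exact norm_add_le _ _
          _ ≤ 1 * K * M * Real.exp (-χ * ξ) +
              R * ((1 + R) ^ i * (1 + K / χ + K) * M * Real.exp (-χ * ξ)) := by
            rw [one_mul]; gcongr
          _ ≤ (1 + R) ^ i * (1 + K / χ + K) * M * Real.exp (-χ * ξ) +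
              R * ((1 + R) ^ i * (1 + K / χ + K) * M * Real.exp (-χ * ξ)) := by
            have h4 : 0 ≤ K / χ := by positivity
            gcongr
            · exact one_le_pow₀ (by linarith)
            · linarith
          _ = _ := by ring
    intro i hi ξ hξ
    refine (hsi i (by omega) ξ hξ).trans ?_
    gcongr
    · linarith
    · omega

/-! ### Existence and uniqueness of fundamental solutions -/

/-- The vector field of the first-order system equivalent to
`φ^{(m)} = a_{m-1} φ^{(m-1)} + ⋯ + a_0 φ`. -/
noncomputable def companionField {m : ℕ} (a : Fin m → ℝ) : (Fin m → ℝ) →L[ℝ] (Fin m → ℝ) :=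
  LinearMap.toContinuousLinearMap
    { toFun := fun v i => if h : (i : ℕ) + 1 < m then v ⟨i + 1, h⟩ else ∑ k, a k * v k
      map_add' := fun v w => by
        ext i
        simp only [Pi.add_apply]
        split_ifs
        · rfl
        · simp [mul_add, Finset.sum_add_distrib]
      map_smul' := fun c v => by
        ext i
        simp only [Pi.smul_apply, smul_eq_mul, RingHom.id_apply]
        split_ifs
        · rfl
        · rw [Finset.mul_sum]
          exact Finset.sum_congr rfl fun k _ => by ring }

theorem companionField_apply {m : ℕ} (a : Fin m → ℝ) (v : Fin m → ℝ) (i : Fin m) :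
    companionField a v i = if h : (i : ℕ) + 1 < m then v ⟨i + 1, h⟩ else ∑ k, a k * v k := rfl

theorem IsFundamentalSolution.hasDerivAt_iteratedDeriv {m : ℕ} {a : Fin m → ℝ} {j : Fin m}
    {φ : ℝ → ℝ} (h : IsFundamentalSolution a j φ) {i : ℕ} (hi : i < m) (ξ : ℝ) :
    HasDerivAt (iteratedDeriv i φ) (iteratedDeriv (i + 1) φ ξ) ξ := by
  rw [iteratedDeriv_succ]
  exact (h.contDiff.differentiable_iteratedDeriv i (by exact_mod_cast hi) ξ).hasDerivAt

theorem IsFundamentalSolution.hasDerivAt_jet {m : ℕ} {a : Fin m → ℝ} {j : Fin m}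
    {φ : ℝ → ℝ} (h : IsFundamentalSolution a j φ) (ξ : ℝ) :
    HasDerivAt (fun ξ => fun i : Fin m => iteratedDeriv i φ ξ)
      (companionField a (fun i : Fin m => iteratedDeriv i φ ξ)) ξ := by
  rw [hasDerivAt_pi]
  intro i
  refine (h.hasDerivAt_iteratedDeriv i.2 ξ).congr_deriv ?_
  rw [companionField_apply]
  split_ifs with hi
  · rfl
  · rw [show (i : ℕ) + 1 = m by omega, h.ode]

theorem IsFundamentalSolution.unique {m : ℕ} {a : Fin m → ℝ} {j : Fin m} {φ ψ : ℝ → ℝ}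
    (hφ : IsFundamentalSolution a j φ) (hψ : IsFundamentalSolution a j ψ) : φ = ψ := by
  have h := ODE_solution_unique_univ (v := fun _ => companionField a) (s := fun _ => Set.univ)
    (t₀ := 0) (fun _ => (companionField a).lipschitz.lipschitzOnWith)
    (fun t => ⟨hφ.hasDerivAt_jet t, trivial⟩) (fun t => ⟨hψ.hasDerivAt_jet t, trivial⟩)
    (by ext i; rw [hφ.init, hψ.init])
  ext ξ
  simpa using congrFun (congrFun h ξ) ⟨0, j.pos⟩

/-- The solution is the first coordinate of `exp(ξA) e_j`, with `A` the companion operator; the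
later coordinates are its successive derivatives. -/
theorem exists_isFundamentalSolution {m : ℕ} (a : Fin m → ℝ) (j : Fin m) :
    ∃ φ, IsFundamentalSolution a j φ := by
  set v : ℝ → Fin m → ℝ := fun ξ =>
    NormedSpace.exp (ξ • companionField a) (Pi.single j 1) with hv
  have hder : ∀ ξ, HasDerivAt v (companionField a (v ξ)) ξ := fun ξ => by
    simpa using (hasDerivAt_exp_smul_const' (companionField a) ξ).clm_apply
      (hasDerivAt_const ξ (Pi.single j (1 : ℝ)))
  have hder' : ∀ i ξ, HasDerivAt (fun ξ => v ξ i) (companionField a (v ξ) i) ξ := fun i ξ =>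
    hasDerivAt_pi.1 (hder ξ) i
  have hi : ∀ i (h : i < m), iteratedDeriv i (fun ξ => v ξ ⟨0, j.pos⟩) = fun ξ => v ξ ⟨i, h⟩ := by
    intro i
    induction i with
    | zero => intro h; simp
    | succ i ih =>
      intro h
      ext ξ
      rw [iteratedDeriv_succ, ih (by omega), (hder' ⟨i, by omega⟩ ξ).deriv, companionField_apply,
        dif_pos h]
  refine ⟨fun ξ => v ξ ⟨0, j.pos⟩, ?_, ?_, ?_⟩
  -- Bootstrapping: `v' = A v` makes `v'` as smooth as `v`.
  · have hsm : ∀ n : ℕ, ContDiff ℝ n v := by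
      intro n
      induction n with
      | zero => exact contDiff_zero.2 (continuous_iff_continuousAt.2 fun ξ => (hder ξ).continuousAt)
      | succ n ih =>
        push_cast
        refine contDiff_succ_iff_deriv.2 ⟨fun ξ => (hder ξ).differentiableAt, by simp, ?_⟩
        rw [funext fun ξ => (hder ξ).deriv]
        exact (companionField a).contDiff.comp ih
    exact contDiff_pi.1 (hsm m) ⟨0, j.pos⟩
  · intro ξ
    obtain ⟨n, rfl⟩ : ∃ n, m = n + 1 := ⟨m - 1, by have := j.pos; omega⟩
    rw [iteratedDeriv_succ, hi n (by omega), (hder' _ ξ).deriv, companionField_apply,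
      dif_neg (by simp)]
    exact Finset.sum_congr rfl fun k _ => by rw [hi k k.2]
  · intro i
    rw [hi i i.2]
    simp [hv, Pi.single_apply]

theorem existsUnique_isFundamentalSolution {m : ℕ} (a : Fin m → ℝ) (j : Fin m) :
    ∃! φ, IsFundamentalSolution a j φ := by
  obtain ⟨φ, hφ⟩ := exists_isFundamentalSolution a j
  exact ⟨φ, hφ, fun ψ hψ => hψ.unique hφ⟩

/-! ### Characteristic polynomial and decay of fundamental solutions -/

open Polynomial in
/-- The characteristic polynomial `z^m - a_{m-1} z^{m-1} - ⋯ - a_0`. -/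
noncomputable def charPolynomial {m : ℕ} (a : Fin m → ℝ) : ℂ[X] :=
  X ^ m - ∑ i : Fin m, C (a i : ℂ) * X ^ (i : ℕ)

theorem charPolynomial_monic {m : ℕ} (a : Fin m → ℝ) : (charPolynomial a).Monic :=
  Polynomial.monic_X_pow_sub (Polynomial.degree_sum_fin_lt _)

theorem charPolynomial_natDegree {m : ℕ} (a : Fin m → ℝ) :
    (charPolynomial a).natDegree = m := by
  apply Polynomial.natDegree_eq_of_degree_eq_some
  unfold charPolynomial
  rw [Polynomial.degree_sub_eq_left_of_degree_lt] <;> rw [Polynomial.degree_X_pow]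
  exact Polynomial.degree_sum_fin_lt _

theorem charPolynomial_coeff {m : ℕ} (a : Fin m → ℝ) (i : Fin m) :
    (charPolynomial a).coeff i = -(a i : ℂ) := by
  have h : ∀ x : Fin m, (i : ℕ) = x ↔ x = i := fun x => by rw [eq_comm, Fin.val_inj]
  simp [charPolynomial, Polynomial.coeff_X_pow, i.2.ne, h]

theorem charPolynomial_isRoot {m : ℕ} {a : Fin m → ℝ} {z : ℂ} :
    (charPolynomial a).IsRoot z ↔ z ^ m = ∑ i : Fin m, (a i : ℂ) * z ^ (i : ℕ) := by
  simp [charPolynomial, Polynomial.IsRoot.def, Polynomial.eval_finsetSum, sub_eq_zero]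

/-- The derivatives of a fundamental solution, of all orders, form a sequence satisfying the
linear recurrence. -/
theorem IsFundamentalSolution.exists_jet {m : ℕ} {a : Fin m → ℝ} {j : Fin m} {φ : ℝ → ℝ}
    (h : IsFundamentalSolution a j φ) : ∃ s : ℕ → ℝ → ℝ,
      (∀ i < m, s i = iteratedDeriv i φ) ∧ (∀ i ξ, HasDerivAt (s i) (s (i + 1) ξ) ξ) ∧
      ∀ i ξ, s (i + m) ξ = ∑ k : Fin m, a k * s (i + k) ξ := by
  -- Only `C^m` regularity is given, so the terms of order `m` and above are generated by the
  -- recurrence, then shown to be successive derivatives.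
  set E : LinearRecurrence ℝ := ⟨m, a⟩ with hE
  set s : ℕ → ℝ → ℝ := fun i ξ => E.mkSol (fun k : Fin m => iteratedDeriv k φ ξ) i with hs
  have h1 : ∀ i < m, s i = iteratedDeriv i φ := fun i hi => by
    ext ξ
    exact E.mkSol_eq_init (fun k : Fin m => iteratedDeriv k φ ξ) ⟨i, hi⟩
  have h2 : ∀ i ξ, s (i + m) ξ = ∑ k : Fin m, a k * s (i + k) ξ := fun i ξ =>
    E.is_sol_mkSol (fun k : Fin m => iteratedDeriv k φ ξ) i
  refine ⟨s, h1, fun i => ?_, h2⟩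
  induction i using Nat.strong_induction_on with
  | _ i ih =>
    intro ξ
    by_cases hi : i < m
    · rw [h1 i hi]
      refine (h.hasDerivAt_iteratedDeriv hi ξ).congr_deriv ?_
      rcases Nat.lt_or_ge (i + 1) m with hi' | hi'
      · rw [h1 _ hi']
      · have e : i + 1 = m := by omega
        rw [e, h.ode]
        have := h2 0 ξ
        rw [zero_add] at this
        rw [this]
        exact Finset.sum_congr rfl fun k _ => by rw [zero_add, h1 k k.2]
    · obtain ⟨n, rfl⟩ := Nat.exists_eq_add_of_le' (not_lt.1 hi)
      rw [show s (n + m) = fun ξ => ∑ k : Fin m, a k * s (n + k) ξ from funext (h2 n)]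
      have e : s (n + m + 1) ξ = ∑ k : Fin m, a k * s (n + k + 1) ξ := by
        rw [show n + m + 1 = n + 1 + m by ring, h2]
        exact Finset.sum_congr rfl fun k _ => by rw [add_right_comm]
      rw [e]
      exact HasDerivAt.fun_sum fun k _ => (ih (n + k) (by omega) ξ).const_mul (a k)

/-- The point is that `C` is chosen before `a`, so one constant serves every `x`. The initial data
are 0 or 1, hence `M = 1`. -/
theorem exists_decay_isFundamentalSolution {χ R : ℝ} (hχ : 0 < χ) (hR : 0 ≤ R) (m : ℕ) :
    ∃ C : ℝ, 0 ≤ C ∧ ∀ a : Fin m → ℝ,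
      (∀ r : ℂ, (charPolynomial a).IsRoot r → ‖r‖ ≤ R ∧ r.re ≤ -(2 * χ)) →
      ∀ (j : Fin m) (φ : ℝ → ℝ), IsFundamentalSolution a j φ →
      ∀ i < m, ∀ ξ, 0 ≤ ξ → |iteratedDeriv i φ ξ| ≤ C * Real.exp (-χ * ξ) := by
  obtain ⟨C, hC, H⟩ := exists_decay_of_roots hχ hR m
  refine ⟨C, hC, fun a ha j φ hφ i hi ξ hξ => ?_⟩
  obtain ⟨s, h1, h2, h3⟩ := hφ.exists_jet
  have := H _ (charPolynomial_monic a) (charPolynomial_natDegree a) ha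
    (fun i ξ => (s i ξ : ℂ)) (fun i ξ => (h2 i ξ).ofReal_comp) (fun i ξ => by
      rw [Finset.sum_range_succ, Finset.sum_range]
      have hc := (charPolynomial_monic a).leadingCoeff
      rw [Polynomial.leadingCoeff, charPolynomial_natDegree] at hc
      simp only [charPolynomial_coeff, hc, h3]
      push_cast
      simp) 1 zero_le_one (fun i hi => by
      rw [h1 i hi, hφ.init ⟨i, hi⟩]
      split_ifs <;> simp) i hi ξ hξ
  simpa [h1 i hi] using this

/-! ### Uniformity in the parameter by compactness -/

/-- A uniform bound and a uniform spectral gap for the roots of a compact family of stable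
polynomials. -/
theorem exists_uniform_root_gap {m : ℕ} {K : Set ℝ} (hK : IsCompact K) {a : Fin m → ℝ → ℝ}
    (ha : ∀ i, ContinuousOn (a i) K)
    (hre : ∀ x ∈ K, ∀ r : ℂ, (charPolynomial fun i => a i x).IsRoot r → r.re < 0) :
    ∃ R χ : ℝ, 0 ≤ R ∧ 0 < χ ∧ ∀ x ∈ K, ∀ r : ℂ, (charPolynomial fun i => a i x).IsRoot r →
      ‖r‖ ≤ R ∧ r.re ≤ -(2 * χ) := by
  obtain ⟨B, hB⟩ : ∃ B, ∀ x ∈ K, ∑ i, |a i x| ≤ B := by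
    obtain ⟨B, hB⟩ := hK.exists_bound_of_continuousOn
      (continuousOn_finsetSum Finset.univ fun i _ => (ha i).abs)
    exact ⟨B, fun x hx => (le_abs_self _).trans (hB x hx)⟩
  have hbound : ∀ x ∈ K, ∀ r : ℂ, (charPolynomial fun i => a i x).IsRoot r →
      ‖r‖ ≤ max 1 B := by
    intro x hx r hr
    -- Cauchy's bound: if `1 < ‖r‖`, every lower power is at most `‖r‖ ^ (m - 1)`, so `‖r‖ ≤ B`.
    by_contra! hlt
    obtain ⟨hr1, hrB⟩ := max_lt_iff.1 hlt
    rw [charPolynomial_isRoot] at hr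
    rcases Nat.eq_zero_or_pos m with rfl | hm
    · simp at hr
    have h1 : ‖r‖ ^ m ≤ B * ‖r‖ ^ (m - 1) := by
      rw [← norm_pow, hr]
      refine (norm_sum_le _ _).trans ((Finset.sum_le_sum fun i _ => ?_).trans
        ((Finset.sum_mul _ _ _).symm.le.trans
          (mul_le_mul_of_nonneg_right (hB x hx) (by positivity))))
      rw [norm_mul, norm_pow, Complex.norm_real, Real.norm_eq_abs]
      gcongr
      · exact hr1.le
      · omega
    have h2 : ‖r‖ ^ m = ‖r‖ * ‖r‖ ^ (m - 1) := by
      rw [← pow_succ', Nat.sub_add_cancel hm]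
    rw [h2] at h1
    exact absurd (le_of_mul_le_mul_right h1 (by positivity)) (not_le.2 hrB)
  set D : Set (ℝ × ℂ) := K ×ˢ Metric.closedBall 0 (max 1 B) with hD
  have hDc : IsCompact D := hK.prod (isCompact_closedBall _ _)
  have hcont : ContinuousOn
      (fun p : ℝ × ℂ => p.2 ^ m - ∑ i, (a i p.1 : ℂ) * p.2 ^ (i : ℕ)) D := by
    refine ContinuousOn.sub (by fun_prop) (continuousOn_finsetSum _ fun i _ => ?_)
    refine ContinuousOn.mul ?_ (by fun_prop)
    exact Complex.continuous_ofReal.comp_continuousOn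
      ((ha i).comp continuousOn_fst fun p hp => hp.1)
  have hZ : IsCompact (D ∩ (fun p : ℝ × ℂ => p.2 ^ m - ∑ i, (a i p.1 : ℂ) * p.2 ^ (i : ℕ)) ⁻¹'
      {0}) := hDc.of_isClosed_subset
    (hcont.preimage_isClosed_of_isClosed hDc.isClosed isClosed_singleton) Set.inter_subset_left
  set Z := D ∩ (fun p : ℝ × ℂ => p.2 ^ m - ∑ i, (a i p.1 : ℂ) * p.2 ^ (i : ℕ)) ⁻¹' {0} with hZd
  have hmem : ∀ x ∈ K, ∀ r : ℂ, (charPolynomial fun i => a i x).IsRoot r → (x, r) ∈ Z :=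
    fun x hx r hr => ⟨⟨hx, mem_closedBall_zero_iff.2 (hbound x hx r hr)⟩,
      sub_eq_zero.2 (charPolynomial_isRoot.1 hr)⟩
  rcases Z.eq_empty_or_nonempty with he | hne
  · refine ⟨max 1 B, 1, by positivity, one_pos, fun x hx r hr => ?_⟩
    have := hmem x hx r hr
    rw [he] at this
    exact this.elim
  -- The pairs (parameter, root) form a compact set, so the largest real part is attained, hence
  -- negative; it becomes `-2χ`.
  · obtain ⟨⟨x₀, r₀⟩, ⟨⟨hx₀, -⟩, hr₀⟩, hmax⟩ := hZ.exists_isMaxOn hne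
      (f := fun p : ℝ × ℂ => p.2.re) (by fun_prop)
    have hneg := hre x₀ hx₀ r₀ (charPolynomial_isRoot.2 (sub_eq_zero.1 hr₀))
    refine ⟨max 1 B, -r₀.re / 2, by positivity, by linarith, fun x hx r hr =>
      ⟨hbound x hx r hr, ?_⟩⟩
    have : r.re ≤ r₀.re := hmax (hmem x hx r hr)
    linarith

theorem corollary2 (m : ℕ) (hm : 1 ≤ m) (X : ℝ) (hX : 0 < X) (a : Fin m → ℝ → ℝ)
    (ha : ∀ i : Fin m, ContDiffOn ℝ 1 (a i) (Set.Icc 0 X))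
    (hRH : ∀ x ∈ Set.Icc (0 : ℝ) X, RouthHurwitz (fun i => a i x)) :
    (∀ x ∈ Set.Icc (0 : ℝ) X,
      (∃! φ : ℝ → ℝ, IsFundamentalSolution (fun i => a i x) ⟨0, by omega⟩ φ) ∧
      (∃! φ : ℝ → ℝ, IsFundamentalSolution (fun i => a i x) ⟨m - 1, by omega⟩ φ)) ∧
    ∀ Φ₁ Φₘ : ℝ → ℝ → ℝ,
      (∀ x ∈ Set.Icc (0 : ℝ) X,
        IsFundamentalSolution (fun i => a i x) ⟨0, by omega⟩ (fun ξ => Φ₁ ξ x)) →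
      (∀ x ∈ Set.Icc (0 : ℝ) X,
        IsFundamentalSolution (fun i => a i x) ⟨m - 1, by omega⟩ (fun ξ => Φₘ ξ x)) →
      ∃ χ > (0 : ℝ), ∃ C > (0 : ℝ),
        ∀ i : ℕ, i ≤ m - 1 → ∀ ξ : ℝ, 0 ≤ ξ → ∀ x ∈ Set.Icc (0 : ℝ) X,
          |iteratedDeriv i (fun η => Φ₁ η x) ξ| ≤ C * (1 + ξ ^ (m - 1)) * Real.exp (-χ * ξ) ∧
          |iteratedDeriv i (fun η => Φₘ η x) ξ| ≤ C * (1 + ξ ^ (m - 1)) * Real.exp (-χ * ξ) := by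
  refine ⟨fun x _ => ⟨existsUnique_isFundamentalSolution _ _,
    existsUnique_isFundamentalSolution _ _⟩, fun Φ₁ Φₘ h₁ hₘ => ?_⟩
  obtain ⟨R, χ, hR, hχ, hroot⟩ := exists_uniform_root_gap isCompact_Icc
    (fun i => (ha i).continuousOn)
    (fun x hx r hr => (hRH x hx).re_neg (charPolynomial_isRoot.1 hr))
  obtain ⟨C, hC, hdecay⟩ := exists_decay_isFundamentalSolution hχ hR m
  -- The pure exponential bound is stronger, since the weight is at least 1; `C + 1` ensures a
  -- positive constant.
  have hweight : ∀ ξ : ℝ, 0 ≤ ξ →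
      C * Real.exp (-χ * ξ) ≤ (C + 1) * (1 + ξ ^ (m - 1)) * Real.exp (-χ * ξ) := by
    intro ξ hξ
    have h : 0 ≤ ξ ^ (m - 1) := pow_nonneg hξ _
    gcongr
    nlinarith
  exact ⟨χ, hχ, C + 1, by positivity, fun i hi ξ hξ x hx =>
    ⟨(hdecay _ (hroot x hx) _ _ (h₁ x hx) i (by omega) ξ hξ).trans (hweight ξ hξ),
      (hdecay _ (hroot x hx) _ _ (hₘ x hx) i (by omega) ξ hξ).trans (hweight ξ hξ)⟩⟩
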